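/- Let $p:[0,1]\to\mathbb R$ be piecewise continuous (continuous at all but finitely many points, with finite one-sided limits everywhere), positive and bounded away from $0$, and let $\alpha\in(0,\pi]$, $\beta\in[0,\pi)$. Let $S(p,\alpha,\beta)$ be the string operator generated by the boundary value problem $$-u''=\lambda\,p(x)\,u\quad (0<x<1),\qquad u(0)\cos\alpha+u'(0)\sin\alpha=0,\qquad u(1)\cos\beta+u'(1)\sin\beta=0,\qquad \lambda\in\mathbb C,$$ where solutions $u$ are continuously differentiable on $[0,1]$ and satisfy the equation at the points of continuity of $p$. All eigenvalues of $S(p,\alpha,\beta)$ are real and there is a lowest one, denoted $\lambda_0(p,\alpha,\beta)$; in particular $\lambda_0(1,\alpha,\beta)$ is the lowest eigenvalue for the constant density $1$. Put $m=\inf_{x\in[0,1]}p(x)^{-1}$ and $M=\sup_{x\in[0,1]}p(x)^{-1}$ (the minimum and maximum of $p^{-1}$ when these are attained). Then $\lambda_0(p,\alpha,\beta)$ lies between $\lambda_0(1,\alpha,\beta)\,m$ and $\lambda_0(1,\alpha,\beta)\,M$. That is, if $\lambda_0(1,\alpha,\beta)\ge 0$, then $$\lambda_0(1,\alpha,\beta)\,m\;\le\;\lambda_0(p,\alpha,\beta)\;\le\;\lambda_0(1,\alpha,\beta)\,M,$$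 and if $\lambda_0(1,\alpha,\beta)\le 0$, then $$\lambda_0(1,\alpha,\beta)\,M\;\le\;\lambda_0(p,\alpha,\beta)\;\le\;\lambda_0(1,\alpha,\beta)\,m.$$ -/

import Mathlib

open Set Filter Topology

/-- `p` is piecewise continuous on `[0, 1]`: it is continuous at all but finitely many points of
`(0, 1)` and has finite one-sided limits at every point of `[0, 1]`. -/
def PiecewiseContinuous (p : ℝ → ℝ) : Prop :=
  {x ∈ Ioo (0 : ℝ) 1 | ¬ ContinuousAt p x}.Finite ∧
  (∀ x ∈ Ico (0 : ℝ) 1, ∃ L : ℝ, Tendsto p (𝓝[>] x) (𝓝 L)) ∧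
  (∀ x ∈ Ioc (0 : ℝ) 1, ∃ L : ℝ, Tendsto p (𝓝[<] x) (𝓝 L))

/-- Density functions of a string: real-valued functions on `[0, 1]` that are piecewise continuous,
positive and bounded away from `0`. Values of `p` outside `[0, 1]` play no role. -/
structure IsDensity (p : ℝ → ℝ) : Prop where
  piecewiseContinuous : PiecewiseContinuous p
  bounded_away : ∃ c : ℝ, 0 < c ∧ ∀ x ∈ Icc (0 : ℝ) 1, c ≤ p x

/-- `u` (with derivative `u'`) is an eigenfunction, for the spectral parameter `μ`, of the problem
`-u'' = μ p u` on `(0, 1)`, `u(0) cos α + u'(0) sin α = 0`, `u(1) cos β + u'(1) sin β = 0`.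
As usual for a piecewise continuous density, `u` is continuously differentiable on `[0, 1]` and the
differential equation holds at the points of continuity of `p`; for such `p` this is the same as
`u'` being absolutely continuous with the equation holding almost everywhere. -/
structure IsEigenfunction (p : ℝ → ℝ) (α β : ℝ) (μ : ℂ) (u u' : ℝ → ℂ) : Prop where
  hasDeriv : ∀ x ∈ Icc (0 : ℝ) 1, HasDerivWithinAt u (u' x) (Icc 0 1) x
  continuousOn_deriv : ContinuousOn u' (Icc 0 1)
  equation : ∀ x ∈ Ioo (0 : ℝ) 1, ContinuousAt p x → HasDerivAt u' (-(μ * (p x : ℂ) * u x)) x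
  boundary_zero : u 0 * (Real.cos α : ℂ) + u' 0 * (Real.sin α : ℂ) = 0
  boundary_one : u 1 * (Real.cos β : ℂ) + u' 1 * (Real.sin β : ℂ) = 0
  nonzero : ∃ x ∈ Icc (0 : ℝ) 1, u x ≠ 0

/-- `μ` is an eigenvalue of the string operator `S(p, α, β)`. -/
def IsStringEigenvalue (p : ℝ → ℝ) (α β : ℝ) (μ : ℂ) : Prop :=
  ∃ u u' : ℝ → ℂ, IsEigenfunction p α β μ u u'

/-- The real number `l` is the lowest eigenvalue of `S(p, α, β)`: it is an eigenvalue, and every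
eigenvalue is real and at least `l`. -/
def IsLowestEigenvalue (p : ℝ → ℝ) (α β l : ℝ) : Prop :=
  IsStringEigenvalue p α β (l : ℂ) ∧
  ∀ μ : ℂ, IsStringEigenvalue p α β μ → μ.im = 0 ∧ l ≤ μ.re

/-- The number `λ₀(p, α, β)`, the infimum of the real eigenvalues of `S(p, α, β)`. -/
noncomputable def lowestEigenvalue (p : ℝ → ℝ) (α β : ℝ) : ℝ :=
  sInf {l : ℝ | IsStringEigenvalue p α β (l : ℂ)}

/-- The infimum of `1 / p` over `[0, 1]` (the minimum whenever it is attained). -/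
noncomputable def infInv (p : ℝ → ℝ) : ℝ := sInf ((fun x => (p x)⁻¹) '' Icc (0 : ℝ) 1)

/-- The supremum of `1 / p` over `[0, 1]` (the maximum whenever it is attained). -/
noncomputable def supInv (p : ℝ → ℝ) : ℝ := sSup ((fun x => (p x)⁻¹) '' Icc (0 : ℝ) 1)

/-! The engine is Picone's identity. If `u > 0` solves `-u'' = l p u` and `v` solves `-v'' = m q v`,
then `F = v v' - v² u' / u` has derivative `(v' - v u' / u)² + (l p - m q) v²`. Equal boundary
conditions make `F` vanish at both ends, so `m q < l p` cannot hold throughout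
(`IsStringSolution.picone`). With `q = p`, an eigenvalue having a positive eigenfunction is the
lowest; with one density equal to `1`, both bounds follow.

A positive eigenfunction comes from shooting (`exists_positive_eigenfunction`). Let `u_l` satisfy
the left boundary condition and let `D l` be the left side of the right one. The set `G` of those
`l` with `u_l > 0` on `(0, 1]` and `D l > 0` is nonempty (`IsStringSolution.pos_of_very_negative`),
bounded above (Picone against a sine) and open. At `sSup G` the solution is nonnegative without
double zeros, hence positive inside, and `D` vanishes. This needs `u_l` jointly continuous in `l`
and `x`, which its power series in `l` provides. -/

/-! ### Boundedness and integrability of densities. -/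

/-- A function with finite one-sided limits on `[0, 1]` is bounded there. -/
theorem PiecewiseContinuous.exists_bound {p : ℝ → ℝ} (hp : PiecewiseContinuous p) :
    ∃ B : ℝ, 0 < B ∧ ∀ x ∈ Icc (0 : ℝ) 1, |p x| ≤ B := by
  have key : ∃ B : ℝ, ∀ x ∈ Icc (0 : ℝ) 1, |p x| ≤ B := by
    refine isCompact_Icc.induction_on (p := fun s => ∃ B : ℝ, ∀ x ∈ s, |p x| ≤ B)
      ⟨0, by simp⟩ ?_ ?_ ?_
    · rintro s t hst ⟨B, hB⟩
      exact ⟨B, fun x hx => hB x (hst hx)⟩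
    · rintro s t ⟨B, hB⟩ ⟨C, hC⟩
      refine ⟨max B C, fun x hx => ?_⟩
      rcases hx with hx | hx
      · exact (hB x hx).trans (le_max_left _ _)
      · exact (hC x hx).trans (le_max_right _ _)
    · intro x hx
      have hr : ∃ B : ℝ, ∀ᶠ y in 𝓝[>] x, y ∈ Icc (0 : ℝ) 1 → |p y| ≤ B := by
        rcases lt_or_ge x 1 with h | h
        · obtain ⟨L, hL⟩ := hp.2.1 x ⟨hx.1, h⟩
          refine ⟨|L| + 1, ?_⟩
          filter_upwards [hL.abs.eventually (gt_mem_nhds (lt_add_one |L|))] with y hy _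
          exact hy.le
        · refine ⟨0, ?_⟩
          filter_upwards [self_mem_nhdsWithin] with y hy hy1
          exact absurd hy1.2 (not_le.2 (lt_of_le_of_lt h hy))
      have hl : ∃ B : ℝ, ∀ᶠ y in 𝓝[<] x, y ∈ Icc (0 : ℝ) 1 → |p y| ≤ B := by
        rcases lt_or_ge 0 x with h | h
        · obtain ⟨L, hL⟩ := hp.2.2 x ⟨h, hx.2⟩
          refine ⟨|L| + 1, ?_⟩
          filter_upwards [hL.abs.eventually (gt_mem_nhds (lt_add_one |L|))] with y hy _
          exact hy.le
        · refine ⟨0, ?_⟩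
          filter_upwards [self_mem_nhdsWithin] with y hy hy1
          exact absurd hy1.1 (not_le.2 (lt_of_lt_of_le hy h))
      obtain ⟨B, hB⟩ := hr
      obtain ⟨C, hC⟩ := hl
      -- One-sided limits say nothing about the value at `x` itself, hence the term `|p x|`.
      refine ⟨{y | y ∈ Icc (0 : ℝ) 1 ∧ |p y| ≤ max (max B C) |p x|}, ?_,
        max (max B C) |p x|, fun y hy => hy.2⟩
      rw [mem_nhdsWithin_iff_eventually]
      rw [eventually_nhdsWithin_iff] at hB hC
      filter_upwards [hB, hC] with y hB hC hy
      refine ⟨hy, ?_⟩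
      rcases lt_trichotomy y x with h | h | h
      · exact ((hC h hy).trans (le_max_right _ _)).trans (le_max_left _ _)
      · rw [h]; exact le_max_right _ _
      · exact ((hB h hy).trans (le_max_left _ _)).trans (le_max_left _ _)
  obtain ⟨B, hB⟩ := key
  exact ⟨max B 1, by positivity, fun x hx => (hB x hx).trans (le_max_left _ _)⟩

theorem PiecewiseContinuous.integrableOn {p : ℝ → ℝ} (hp : PiecewiseContinuous p) :
    MeasureTheory.IntegrableOn p (Icc 0 1) := by
  obtain ⟨B, -, hB⟩ := hp.exists_bound
  set S := {x ∈ Ioo (0 : ℝ) 1 | ¬ ContinuousAt p x} with hS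
  have hSf : S.Finite := hp.1
  have hc : ContinuousOn p (Ioo 0 1 \ S) := by
    intro x hx
    have : ContinuousAt p x := by
      by_contra h
      exact hx.2 ⟨hx.1, h⟩
    exact this.continuousWithinAt
  have hm : MeasureTheory.AEStronglyMeasurable p
      (MeasureTheory.volume.restrict (Icc (0 : ℝ) 1)) := by
    have h1 := hc.aestronglyMeasurable (μ := MeasureTheory.volume)
      (measurableSet_Ioo.diff hSf.measurableSet)
    have h2 : (Ioo (0 : ℝ) 1 \ S : Set ℝ) =ᵐ[MeasureTheory.volume] Icc (0 : ℝ) 1 :=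
      (MeasureTheory.sdiff_null_ae_eq_self (hSf.measure_zero _)).trans
        MeasureTheory.Ioo_ae_eq_Icc
    rwa [MeasureTheory.Measure.restrict_congr_set h2] at h1
  refine MeasureTheory.Integrable.of_bound hm B ?_
  filter_upwards [MeasureTheory.ae_restrict_mem measurableSet_Icc] with x hx
  exact hB x hx

/-! ### Monotonicity and nonvanishing off a finite set. -/

/-- A continuous function whose derivative is nonnegative off a finite set is monotone. -/
theorem le_of_hasDerivAt_nonneg_off_finite {S : Set ℝ} (hS : S.Finite) :
    ∀ {a b : ℝ} {f f' : ℝ → ℝ}, a ≤ b → ContinuousOn f (Icc a b) →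
      (∀ x ∈ Ioo a b, x ∉ S → HasDerivAt f (f' x) x) →
      (∀ x ∈ Ioo a b, x ∉ S → 0 ≤ f' x) → f a ≤ f b := by
  induction S, hS using Set.Finite.induction_on with
  | empty =>
    intro a b f f' hab hf hd hn
    have := monotoneOn_of_hasDerivWithinAt_nonneg (f' := f') (convex_Icc a b) hf
      (fun x hx => by
        rw [interior_Icc] at hx ⊢
        exact (hd x hx (by simp)).hasDerivWithinAt)
      (fun x hx => by
        rw [interior_Icc] at hx
        exact hn x hx (by simp))
    exact this (left_mem_Icc.2 hab) (right_mem_Icc.2 hab) hab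
  | @insert s S hs hSf ih =>
    intro a b f f' hab hf hd hn
    -- An interior exceptional point cuts the interval in two; continuity of `f` joins the two
    -- inequalities.
    by_cases hsab : s ∈ Ioo a b
    · have h1 : f a ≤ f s := by
        refine ih hsab.1.le (hf.mono (Icc_subset_Icc_right hsab.2.le)) (f' := f') ?_ ?_
        · intro x hx hxS
          refine hd x ⟨hx.1, hx.2.trans hsab.2⟩ ?_
          simp [hxS, hx.2.ne]
        · intro x hx hxS
          refine hn x ⟨hx.1, hx.2.trans hsab.2⟩ ?_
          simp [hxS, hx.2.ne]
      have h2 : f s ≤ f b := by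
        refine ih hsab.2.le (hf.mono (Icc_subset_Icc_left hsab.1.le)) (f' := f') ?_ ?_
        · intro x hx hxS
          refine hd x ⟨hsab.1.trans hx.1, hx.2⟩ ?_
          simp [hxS, hx.1.ne']
        · intro x hx hxS
          refine hn x ⟨hsab.1.trans hx.1, hx.2⟩ ?_
          simp [hxS, hx.1.ne']
      exact h1.trans h2
    · refine ih hab hf (f' := f') ?_ ?_
      · intro x hx hxS
        refine hd x hx ?_
        simp only [mem_insert_iff, not_or]
        exact ⟨fun h => hsab (h ▸ hx), hxS⟩
      · intro x hx hxS
        refine hn x hx ?_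
        simp only [mem_insert_iff, not_or]
        exact ⟨fun h => hsab (h ▸ hx), hxS⟩

theorem monotoneOn_of_hasDerivAt_nonneg_off_finite {S : Set ℝ} (hS : S.Finite) {a b : ℝ}
    {f f' : ℝ → ℝ} (hf : ContinuousOn f (Icc a b))
    (hd : ∀ x ∈ Ioo a b, x ∉ S → HasDerivAt f (f' x) x)
    (hn : ∀ x ∈ Ioo a b, x ∉ S → 0 ≤ f' x) : MonotoneOn f (Icc a b) := by
  intro x hx y hy hxy
  refine le_of_hasDerivAt_nonneg_off_finite hS hxy (hf.mono (Icc_subset_Icc hx.1 hy.2))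
    (f' := f') ?_ ?_
  · intro z hz
    exact hd z ⟨hx.1.trans_lt hz.1, hz.2.trans_le hy.2⟩
  · intro z hz
    exact hn z ⟨hx.1.trans_lt hz.1, hz.2.trans_le hy.2⟩

/-- A continuous function on `[0, 1]` with equal end values whose derivative is nonnegative off a
finite set has zero derivative off that set. -/
theorem deriv_eq_zero_of_nonneg_of_endpoints_eq {S : Set ℝ} (hS : S.Finite)
    {f f' : ℝ → ℝ} (hf : ContinuousOn f (Icc 0 1))
    (hd : ∀ x ∈ Ioo (0 : ℝ) 1, x ∉ S → HasDerivAt f (f' x) x)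
    (hn : ∀ x ∈ Ioo (0 : ℝ) 1, x ∉ S → 0 ≤ f' x) (h01 : f 0 = f 1) {x : ℝ}
    (hx : x ∈ Ioo (0 : ℝ) 1) (hxS : x ∉ S) : f' x = 0 := by
  have hm := monotoneOn_of_hasDerivAt_nonneg_off_finite hS hf hd hn
  have h0 : (0 : ℝ) ∈ Icc (0 : ℝ) 1 := by simp
  have h1 : (1 : ℝ) ∈ Icc (0 : ℝ) 1 := by simp
  have hc : f =ᶠ[𝓝 x] fun _ => f 0 := by
    filter_upwards [Ioo_mem_nhds hx.1 hx.2] with y hy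
    have hy' := Ioo_subset_Icc_self hy
    exact le_antisymm ((hm hy' h1 hy.2.le).trans h01.ge) (hm h0 hy' hy.1.le)
  exact (hd x hx hxS).unique ((hasDerivAt_const x (f 0)).congr_of_eventuallyEq hc)

/-- A function continuous and not identically zero on `[0, 1]` is nonzero at a point of `(0, 1)`
outside a given finite set. -/
theorem exists_ne_zero_off_finite {E : Type*} [NormedAddCommGroup E] {S : Set ℝ} (hS : S.Finite)
    {f : ℝ → E} (hf : ContinuousOn f (Icc 0 1)) (hne : ∃ x ∈ Icc (0 : ℝ) 1, f x ≠ 0) :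
    ∃ x ∈ Ioo (0 : ℝ) 1, x ∉ S ∧ f x ≠ 0 := by
  by_contra! h
  obtain ⟨x, hx, hfx⟩ := hne
  apply hfx
  have hd : Icc (0 : ℝ) 1 ⊆ closure (Ioo 0 1 ∩ Sᶜ) := by
    have hden : Dense (Sᶜ : Set ℝ) := hS.countable.dense_compl ℝ
    have h := hden.open_subset_closure_inter (isOpen_Ioo (a := (0 : ℝ)) (b := 1))
    rw [← closure_Ioo (zero_ne_one' ℝ)]
    exact closure_minimal h isClosed_closure
  have hm := ((hf x hx).mono (inter_subset_left.trans Ioo_subset_Icc_self)).mem_closure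
    (hd hx) (t := {0}) (fun y hy => h y hy.1 hy.2)
  simpa using hm

/-! ### Real solutions and uniqueness for the Cauchy problem. -/

/-- `u`, with derivative `w`, is a real solution of `-u'' = l p u` on `[0, 1]`. -/
structure IsStringSolution (p : ℝ → ℝ) (l : ℝ) (u w : ℝ → ℝ) : Prop where
  hasDeriv : ∀ x ∈ Icc (0 : ℝ) 1, HasDerivWithinAt u (w x) (Icc 0 1) x
  continuousOn_deriv : ContinuousOn w (Icc 0 1)
  equation : ∀ x ∈ Ioo (0 : ℝ) 1, ContinuousAt p x → HasDerivAt w (-(l * p x * u x)) x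

namespace IsStringSolution

variable {p : ℝ → ℝ} {l : ℝ} {u w : ℝ → ℝ}

theorem continuousOn (h : IsStringSolution p l u w) : ContinuousOn u (Icc 0 1) :=
  fun x hx => (h.hasDeriv x hx).continuousWithinAt

theorem hasDerivAt (h : IsStringSolution p l u w) {x : ℝ} (hx : x ∈ Ioo (0 : ℝ) 1) :
    HasDerivAt u (w x) x :=
  (h.hasDeriv x (Ioo_subset_Icc_self hx)).hasDerivAt (Icc_mem_nhds hx.1 hx.2)

/-- A solution with vanishing Cauchy data at one point vanishes identically. -/
theorem eq_zero_of_cauchy_data (h : IsStringSolution p l u w) (hp : PiecewiseContinuous p)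
    {x₀ : ℝ} (hx₀ : x₀ ∈ Icc (0 : ℝ) 1) (hu : u x₀ = 0) (hw : w x₀ = 0) {x : ℝ}
    (hx : x ∈ Icc (0 : ℝ) 1) : u x = 0 ∧ w x = 0 := by
  obtain ⟨B, hB0, hB⟩ := hp.exists_bound
  -- Gronwall: `E = u² + w²` satisfies `|E'| ≤ K E`, so `exp (K x) E` increases and `exp (-K x) E`
  -- decreases. A zero of `E` at `x₀` then forces `E ≤ 0` to its left and to its right respectively.
  set K : ℝ := 1 + |l| * B with hK
  have hE : ContinuousOn (fun x => u x ^ 2 + w x ^ 2) (Icc 0 1) :=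
    (h.continuousOn.pow 2).add (h.continuousOn_deriv.pow 2)
  have hEd : ∀ x ∈ Ioo (0 : ℝ) 1, x ∉ {x ∈ Ioo (0 : ℝ) 1 | ¬ ContinuousAt p x} →
      HasDerivAt (fun x => u x ^ 2 + w x ^ 2) (2 * u x * w x * (1 - l * p x)) x := by
    intro x hx hxS
    have hc : ContinuousAt p x := by
      by_contra hc
      exact hxS ⟨hx, hc⟩
    have := ((h.hasDerivAt hx).pow 2).add ((h.equation x hx hc).pow 2)
    refine this.congr_deriv ?_
    simp
    ring
  have hbd : ∀ x ∈ Ioo (0 : ℝ) 1,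
      |2 * u x * w x * (1 - l * p x)| ≤ K * (u x ^ 2 + w x ^ 2) := by
    intro x hx
    rw [abs_mul, mul_comm K]
    refine mul_le_mul ?_ ?_ (abs_nonneg _) (by positivity)
    · rw [abs_le]
      constructor <;> nlinarith [sq_nonneg (u x + w x), sq_nonneg (u x - w x)]
    · refine (abs_sub _ _).trans ?_
      rw [abs_one, abs_mul]
      have := hB x (Ioo_subset_Icc_self hx)
      have := mul_le_mul_of_nonneg_left this (abs_nonneg l)
      linarith
  have hexp : ∀ (c x : ℝ), HasDerivAt (fun x => Real.exp (c * x)) (Real.exp (c * x) * c) x := by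
    intro c x
    simpa using ((hasDerivAt_id x).const_mul c).exp
  have hfin : u x ^ 2 + w x ^ 2 ≤ 0 := by
    rcases le_total x x₀ with hxx | hxx
    · have hm := monotoneOn_of_hasDerivAt_nonneg_off_finite hp.1
        (f := fun x => Real.exp (K * x) * (u x ^ 2 + w x ^ 2))
        (f' := fun x => Real.exp (K * x) * K * (u x ^ 2 + w x ^ 2) +
          Real.exp (K * x) * (2 * u x * w x * (1 - l * p x)))
        ((Continuous.continuousOn (by fun_prop)).mul hE)
        (fun x hx hxS => (hexp K x).mul (hEd x hx hxS))
        (fun x hx _ => by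
          have h1 := (abs_le.1 (hbd x hx)).1
          have h2 := Real.exp_pos (K * x)
          nlinarith)
      have := hm hx hx₀ hxx
      simp only [hu, hw] at this
      have h2 := Real.exp_pos (K * x)
      by_contra! hpos
      have := mul_pos h2 hpos
      norm_num at *
      linarith
    · have hm := monotoneOn_of_hasDerivAt_nonneg_off_finite hp.1
        (f := fun x => -(Real.exp (-K * x) * (u x ^ 2 + w x ^ 2)))
        (f' := fun x => -(Real.exp (-K * x) * (-K) * (u x ^ 2 + w x ^ 2) +
          Real.exp (-K * x) * (2 * u x * w x * (1 - l * p x))))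
        ((Continuous.continuousOn (by fun_prop)).mul hE).neg
        (fun x hx hxS => ((hexp (-K) x).mul (hEd x hx hxS)).neg)
        (fun x hx _ => by
          have h1 := (abs_le.1 (hbd x hx)).2
          have h2 := Real.exp_pos (-K * x)
          nlinarith)
      have := hm hx₀ hx hxx
      simp only [hu, hw] at this
      have h2 := Real.exp_pos (-K * x)
      by_contra! hpos
      have := mul_pos h2 hpos
      norm_num at *
      linarith
  constructor <;> nlinarith [sq_nonneg (u x), sq_nonneg (w x)]

end IsStringSolution

/-! ### Picone's identity. -/

/-- Near a common zero of `v` and `u`, where the zero of `u` is simple, `v / u` is bounded, so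
`v ^ 2 * z / u` tends to zero. -/
theorem tendsto_sq_mul_div_of_simple_zero {s : Set ℝ} {u v z : ℝ → ℝ} {a u' v' : ℝ}
    (hu : HasDerivWithinAt u u' s a) (hv : HasDerivWithinAt v v' s a)
    (hz : ContinuousWithinAt z s a) (hua : u a = 0) (hva : v a = 0) (hu' : u' ≠ 0) :
    Tendsto (fun x => v x ^ 2 * z x / u x) (𝓝[s] a) (𝓝 0) := by
  have h1 : Tendsto (fun x => v x * z x * (slope v a x / slope u a x)) (𝓝[s \ {a}] a)
      (𝓝 (v a * z a * (v' / u'))) :=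
    Tendsto.mul ((hv.continuousWithinAt.mono sdiff_subset).mul (hz.mono sdiff_subset))
      ((hasDerivWithinAt_iff_tendsto_slope.1 hv).div (hasDerivWithinAt_iff_tendsto_slope.1 hu) hu')
  rw [hva, zero_mul, zero_mul] at h1
  have h2 : Tendsto (fun x => v x ^ 2 * z x / u x) (𝓝[s \ {a}] a) (𝓝 0) := by
    refine h1.congr' ?_
    filter_upwards [self_mem_nhdsWithin] with x hx
    have hxa : x - a ≠ 0 := sub_ne_zero.2 hx.2
    rw [slope_def_field, slope_def_field, hua, hva, sub_zero, sub_zero,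
      div_div_div_cancel_right₀ hxa]
    ring
  -- Division by zero gives the quotient the value `0` at `a`, which agrees with the punctured
  -- limit.
  have h3 : ContinuousWithinAt (fun x => v x ^ 2 * z x / u x) (s \ {a}) a := by
    have : v a ^ 2 * z a / u a = 0 := by simp [hua]
    unfold ContinuousWithinAt
    simpa only [this] using h2
  have h4 := continuousWithinAt_sdiff_self.1 h3
  unfold ContinuousWithinAt at h4
  simpa [hua] using h4

/-- The boundary condition under which the Picone function of `v` relative to `u` extends
continuously by zero to the end point `e`. -/
def PiconeBoundary (u w v z : ℝ → ℝ) (e : ℝ) : Prop :=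
  (u e ≠ 0 ∧ v e * (z e * u e - v e * w e) = 0) ∨ (u e = 0 ∧ w e ≠ 0 ∧ v e = 0)

/-- Picone comparison: if `u > 0` solves `-u'' = l p u` and `v ≠ 0` solves `-v'' = m q v` with
matching boundary behaviour, then `m q < l p` cannot hold throughout. -/
theorem IsStringSolution.picone {p q : ℝ → ℝ} {l m : ℝ} {u w v z : ℝ → ℝ}
    (hu : IsStringSolution p l u w) (hv : IsStringSolution q m v z)
    (hp : PiecewiseContinuous p) (hq : PiecewiseContinuous q)
    (hpos : ∀ x ∈ Ioo (0 : ℝ) 1, 0 < u x) (hne : ∃ x ∈ Icc (0 : ℝ) 1, v x ≠ 0)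
    (h0 : PiconeBoundary u w v z 0) (h1 : PiconeBoundary u w v z 1) :
    ¬ ∀ x ∈ Ioo (0 : ℝ) 1, m * q x < l * p x := by
  intro hlt
  set S := {x ∈ Ioo (0 : ℝ) 1 | ¬ ContinuousAt p x} ∪ {x ∈ Ioo (0 : ℝ) 1 | ¬ ContinuousAt q x}
    with hS
  have hSf : S.Finite := hp.1.union hq.1
  set F : ℝ → ℝ := fun x => v x * z x - v x ^ 2 * w x / u x with hF
  set F' : ℝ → ℝ := fun x => (z x - v x * w x / u x) ^ 2 + (l * p x - m * q x) * v x ^ 2 with hF'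
  have hend : ∀ e ∈ Icc (0 : ℝ) 1, PiconeBoundary u w v z e →
      F e = 0 ∧ ContinuousWithinAt F (Icc 0 1) e := by
    rintro e he (⟨hue, h⟩ | ⟨hue, hwe, hve⟩)
    · constructor
      · simp only [hF]
        field_simp
        linear_combination h
      · exact ((hv.continuousOn e he).mul (hv.continuousOn_deriv e he)).sub
          ((((hv.continuousOn e he).pow 2).mul (hu.continuousOn_deriv e he)).div
            (hu.continuousOn e he) hue)
    · have hFe : F e = 0 := by simp [hF, hue, hve]
      refine ⟨hFe, ?_⟩
      have ht := tendsto_sq_mul_div_of_simple_zero (hu.hasDeriv e he) (hv.hasDeriv e he)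
        (hu.continuousOn_deriv e he) hue hve hwe
      have ht2 : Tendsto (fun x => v x * z x) (𝓝[Icc 0 1] e) (𝓝 (v e * z e)) :=
        (hv.continuousOn e he).mul (hv.continuousOn_deriv e he)
      have := ht2.sub ht
      rw [hve, zero_mul, sub_zero] at this
      unfold ContinuousWithinAt
      rwa [hFe]
  have hFc : ContinuousOn F (Icc 0 1) := by
    intro x hx
    rcases hx.1.eq_or_lt with h | h
    · rw [← h] at hx ⊢
      exact (hend 0 hx h0).2
    rcases hx.2.eq_or_lt with h' | h'
    · rw [h'] at hx ⊢
      exact (hend 1 hx h1).2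
    · exact ((hv.continuousOn x hx).mul (hv.continuousOn_deriv x hx)).sub
          ((((hv.continuousOn x hx).pow 2).mul (hu.continuousOn_deriv x hx)).div
            (hu.continuousOn x hx) (hpos x ⟨h, h'⟩).ne')
  have hFd : ∀ x ∈ Ioo (0 : ℝ) 1, x ∉ S → HasDerivAt F (F' x) x := by
    intro x hx hxS
    have hcp : ContinuousAt p x := by
      by_contra hc
      exact hxS (Or.inl ⟨hx, hc⟩)
    have hcq : ContinuousAt q x := by
      by_contra hc
      exact hxS (Or.inr ⟨hx, hc⟩)
    have hux := (hpos x hx).ne'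
    have := ((hv.hasDerivAt hx).mul (hv.equation x hx hcq)).sub
      ((((hv.hasDerivAt hx).pow 2).mul (hu.equation x hx hcp)).div (hu.hasDerivAt hx) hux)
    refine this.congr_deriv ?_
    simp only [hF', Pi.mul_apply, Pi.pow_apply]
    field_simp
    push_cast
    ring
  have hFn : ∀ x ∈ Ioo (0 : ℝ) 1, x ∉ S → 0 ≤ F' x := fun x hx _ =>
    add_nonneg (sq_nonneg _) (mul_nonneg (sub_nonneg.2 (hlt x hx).le) (sq_nonneg _))
  obtain ⟨x, hx, hxS, hvx⟩ := exists_ne_zero_off_finite hSf hv.continuousOn hne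
  have hzero := deriv_eq_zero_of_nonneg_of_endpoints_eq hSf hFc hFd hFn
    ((hend 0 (by simp) h0).1.trans (hend 1 (by simp) h1).1.symm) hx hxS
  -- The strict inequality is used only here, at a point where `v` does not vanish.
  have : 0 < F' x := add_pos_of_nonneg_of_pos (sq_nonneg _)
    (mul_pos (sub_pos.2 (hlt x hx)) (by positivity))
  exact this.ne' hzero

/-! ### Solutions as power series in the spectral parameter. -/

/-- The coefficients, with their derivatives, of the power series in `-l` of the solution of
`-u'' = l p u`, `u(0) = a`, `u'(0) = b`. -/
noncomputable def stringCoeff (p : ℝ → ℝ) (a b : ℝ) : ℕ → (ℝ → ℝ) × (ℝ → ℝ)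
  | 0 => (fun x => a + b * x, fun _ => b)
  | n + 1 => (fun x => ∫ s in (0 : ℝ)..x, ∫ t in (0 : ℝ)..s, p t * (stringCoeff p a b n).1 t,
      fun x => ∫ t in (0 : ℝ)..x, p t * (stringCoeff p a b n).1 t)

section Series

variable {p : ℝ → ℝ} (a b : ℝ)

theorem PiecewiseContinuous.integrableOn_mul (hp : PiecewiseContinuous p) {f : ℝ → ℝ}
    (hf : ContinuousOn f (Icc 0 1)) :
    MeasureTheory.IntegrableOn (fun t => p t * f t) (Icc 0 1) :=
  hp.integrableOn.mul_continuousOn hf isCompact_Icc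

theorem intervalIntegrable_of_integrableOn_Icc {f : ℝ → ℝ}
    (hf : MeasureTheory.IntegrableOn f (Icc 0 1)) {x : ℝ} (hx : x ∈ Icc (0 : ℝ) 1) :
    IntervalIntegrable f MeasureTheory.volume 0 x := by
  rw [intervalIntegrable_iff_integrableOn_Icc_of_le hx.1]
  exact hf.mono_set (Icc_subset_Icc_right hx.2)

theorem continuousOn_primitive_Icc {f : ℝ → ℝ}
    (hf : MeasureTheory.IntegrableOn f (Icc 0 1)) :
    ContinuousOn (fun x => ∫ t in (0 : ℝ)..x, f t) (Icc 0 1) := by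
  have h := intervalIntegral.continuousOn_primitive_interval (μ := MeasureTheory.volume)
    (f := f) (a := 0) (b := 1)
  rw [uIcc_of_le zero_le_one] at h
  exact h hf

theorem stringCoeff_continuousOn (hp : PiecewiseContinuous p) (n : ℕ) :
    ContinuousOn (stringCoeff p a b n).1 (Icc 0 1) ∧
      ContinuousOn (stringCoeff p a b n).2 (Icc 0 1) := by
  induction n with
  | zero =>
    simp only [stringCoeff]
    exact ⟨by fun_prop, by fun_prop⟩
  | succ n ih =>
    have h2 : ContinuousOn (stringCoeff p a b (n + 1)).2 (Icc 0 1) :=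
      continuousOn_primitive_Icc (hp.integrableOn_mul ih.1)
    exact ⟨continuousOn_primitive_Icc (h2.integrableOn_Icc), h2⟩

theorem stringCoeff_fst_eq (n : ℕ) (x : ℝ) :
    (stringCoeff p a b n).1 x =
      (if n = 0 then a else 0) + ∫ t in (0 : ℝ)..x, (stringCoeff p a b n).2 t := by
  cases n with
  | zero => simp [stringCoeff, mul_comm]
  | succ n => simp [stringCoeff]

/-- Each integration against `p` gains a factor `B x / (n + 1)`; the second integration costs
nothing because `x ≤ 1`. The factorial makes the series converge for every `l`, uniformly on bounded
sets. -/
theorem stringCoeff_bound {B : ℝ} (hB0 : 0 ≤ B) (hB : ∀ x ∈ Icc (0 : ℝ) 1, |p x| ≤ B) (n : ℕ) :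
    ∀ x ∈ Icc (0 : ℝ) 1,
      |(stringCoeff p a b n).1 x| ≤ (|a| + |b|) * (B ^ n * x ^ n / n.factorial) ∧
      |(stringCoeff p a b n).2 x| ≤ (|a| + |b|) * (B ^ n * x ^ n / n.factorial) := by
  induction n with
  | zero =>
    intro x hx
    simp only [stringCoeff, pow_zero, Nat.factorial_zero, Nat.cast_one, mul_one, div_one]
    refine ⟨(abs_add_le _ _).trans ?_, ?_⟩
    · rw [abs_mul, abs_of_nonneg hx.1]
      have := mul_le_mul_of_nonneg_left hx.2 (abs_nonneg b)
      linarith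
    · linarith [abs_nonneg a]
  | succ n ih =>
    have h2 : ∀ x ∈ Icc (0 : ℝ) 1, |(stringCoeff p a b (n + 1)).2 x| ≤
        (|a| + |b|) * (B ^ (n + 1) * x ^ (n + 1) / (n + 1).factorial) := by
      intro x hx
      have h := intervalIntegral.norm_integral_le_of_norm_le (μ := MeasureTheory.volume)
        (f := fun t => p t * (stringCoeff p a b n).1 t)
        (g := fun t => B * ((|a| + |b|) * (B ^ n * t ^ n / n.factorial))) hx.1
        (MeasureTheory.ae_of_all _ fun t ht => by
          have ht' : t ∈ Icc (0 : ℝ) 1 := ⟨ht.1.le, ht.2.trans hx.2⟩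
          rw [Real.norm_eq_abs, abs_mul]
          exact mul_le_mul (hB t ht') (ih t ht').1 (abs_nonneg _) hB0)
        (Continuous.intervalIntegrable (by fun_prop) _ _)
      refine h.trans (le_of_eq ?_)
      have hg : (fun t : ℝ => B * ((|a| + |b|) * (B ^ n * t ^ n / n.factorial))) =
          fun t => (B * (|a| + |b|) * B ^ n / n.factorial) * t ^ n := by
        funext t
        ring
      rw [hg, intervalIntegral.integral_const_mul, integral_pow, Nat.factorial_succ]
      push_cast
      have : (n.factorial : ℝ) ≠ 0 := by positivity
      field_simp
      ring
    intro x hx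
    refine ⟨?_, h2 x hx⟩
    have h := intervalIntegral.norm_integral_le_of_norm_le_const
      (f := (stringCoeff p a b (n + 1)).2) (a := 0) (b := x)
      (C := (|a| + |b|) * (B ^ (n + 1) * x ^ (n + 1) / (n + 1).factorial)) (by
        intro t ht
        rw [uIoc_of_le hx.1] at ht
        have ht0 : 0 ≤ t := ht.1.le
        refine (h2 t ⟨ht.1.le, ht.2.trans hx.2⟩).trans ?_
        gcongr
        exact ht.2)
    refine h.trans ?_
    rw [sub_zero, abs_of_nonneg hx.1]
    refine mul_le_of_le_one_right ?_ hx.2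
    have := hx.1
    positivity

/-- Existence of the solutions of `-u'' = l p u` with given Cauchy data at `0`, depending
continuously on the spectral parameter. -/
theorem exists_stringSolution_family (hp : PiecewiseContinuous p) :
    ∃ u w : ℝ → ℝ → ℝ, (∀ l, IsStringSolution p l (u l) (w l)) ∧
      (∀ l, u l 0 = a ∧ w l 0 = b) ∧
      ContinuousOn (fun y : ℝ × ℝ => u y.1 y.2) (univ ×ˢ Icc 0 1) ∧
      ContinuousOn (fun y : ℝ × ℝ => w y.1 y.2) (univ ×ˢ Icc 0 1) := by
  obtain ⟨B, hB0, hB⟩ := hp.exists_bound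
  set U : ℕ → ℝ → ℝ := fun n => (stringCoeff p a b n).1 with hU
  set V : ℕ → ℝ → ℝ := fun n => (stringCoeff p a b n).2 with hV
  have hUc : ∀ n, ContinuousOn (U n) (Icc 0 1) := fun n => (stringCoeff_continuousOn a b hp n).1
  have hVc : ∀ n, ContinuousOn (V n) (Icc 0 1) := fun n => (stringCoeff_continuousOn a b hp n).2
  set M : ℝ → ℕ → ℝ := fun R n => (|a| + |b|) * ((R * B) ^ n / n.factorial) with hM
  have hMs : ∀ R, Summable (M R) := fun R => (Real.summable_pow_div_factorial (R * B)).mul_left _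
  have hbound : ∀ {R l : ℝ} {n : ℕ} {x y : ℝ}, |l| ≤ R → x ∈ Icc (0 : ℝ) 1 →
      |y| ≤ (|a| + |b|) * (B ^ n * x ^ n / n.factorial) → ‖(-l) ^ n * y‖ ≤ M R n := by
    intro R l n x y hl hx hy
    have hx0 := hx.1
    have hR : 0 ≤ R := (abs_nonneg l).trans hl
    rw [Real.norm_eq_abs, abs_mul, abs_pow, abs_neg]
    calc |l| ^ n * |y| ≤ R ^ n * ((|a| + |b|) * (B ^ n * 1 ^ n / n.factorial)) := by
          gcongr
          refine hy.trans ?_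
          gcongr
          exact hx.2
      _ = M R n := by
          simp only [hM, one_pow, mul_pow]
          ring
  have hUb : ∀ {R l : ℝ} (n : ℕ) {x : ℝ}, |l| ≤ R → x ∈ Icc (0 : ℝ) 1 →
      ‖(-l) ^ n * U n x‖ ≤ M R n := fun n x hl hx =>
    hbound hl hx (stringCoeff_bound a b hB0.le hB n x hx).1
  have hVb : ∀ {R l : ℝ} (n : ℕ) {x : ℝ}, |l| ≤ R → x ∈ Icc (0 : ℝ) 1 →
      ‖(-l) ^ n * V n x‖ ≤ M R n := fun n x hl hx =>
    hbound hl hx (stringCoeff_bound a b hB0.le hB n x hx).2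
  -- The majorant depends on a bound for `|l|`, so the Weierstrass test is applied on the strip of
  -- radius `1` around each `l`.
  have hjoint : ∀ f : ℕ → ℝ → ℝ, (∀ n, ContinuousOn (f n) (Icc 0 1)) →
      (∀ {R l : ℝ} (n : ℕ) {x : ℝ}, |l| ≤ R → x ∈ Icc (0 : ℝ) 1 → ‖(-l) ^ n * f n x‖ ≤ M R n) →
      ContinuousOn (fun y : ℝ × ℝ => ∑' n, (-y.1) ^ n * f n y.2) (univ ×ˢ Icc 0 1) := by
    intro f hf hfb
    rintro ⟨l, x⟩ ⟨-, hx⟩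
    have h1 : ContinuousOn (fun y : ℝ × ℝ => ∑' n, (-y.1) ^ n * f n y.2)
        (Icc (l - 1) (l + 1) ×ˢ Icc 0 1) := by
      refine continuousOn_tsum (u := M (|l| + 1)) ?_ (hMs _) ?_
      · intro n
        refine ContinuousOn.mul (by fun_prop) ?_
        exact (hf n).comp continuous_snd.continuousOn fun y hy => hy.2
      · rintro n ⟨k, y⟩ ⟨hk, hy⟩
        refine hfb n ?_ hy
        have h1 : |k - l| ≤ 1 := abs_le.2 ⟨by linarith [hk.1], by linarith [hk.2]⟩
        have h2 := abs_sub_abs_le_abs_sub k l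
        linarith
    refine (h1 (l, x) ⟨⟨by linarith, by linarith⟩, hx⟩).mono_of_mem_nhdsWithin ?_
    rw [nhdsWithin_prod_eq]
    refine prod_mem_prod ?_ self_mem_nhdsWithin
    rw [nhdsWithin_univ]
    exact Icc_mem_nhds (by linarith) (by linarith)
  set u : ℝ → ℝ → ℝ := fun l x => ∑' n, (-l) ^ n * U n x with hu
  set w : ℝ → ℝ → ℝ := fun l x => ∑' n, (-l) ^ n * V n x with hw
  have huc := hjoint U hUc hUb
  have hwc := hjoint V hVc hVb
  have hul : ∀ l, ContinuousOn (u l) (Icc 0 1) := fun l =>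
    huc.comp (f := fun x => (l, x)) (by fun_prop) fun x hx => ⟨mem_univ _, hx⟩
  have hwl : ∀ l, ContinuousOn (w l) (Icc 0 1) := fun l =>
    hwc.comp (f := fun x => (l, x)) (by fun_prop) fun x hx => ⟨mem_univ _, hx⟩
  have hUs : ∀ l, ∀ x ∈ Icc (0 : ℝ) 1, Summable fun n => (-l) ^ n * U n x := fun l x hx =>
    Summable.of_norm_bounded (hMs |l|) fun n => hUb n le_rfl hx
  have hVs : ∀ l, ∀ x ∈ Icc (0 : ℝ) 1, Summable fun n => (-l) ^ n * V n x := fun l x hx =>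
    Summable.of_norm_bounded (hMs |l|) fun n => hVb n le_rfl hx
  -- Termwise integration gives a pair of integral equations; differentiating these replaces
  -- differentiation of the series.
  have hueq : ∀ l, ∀ x ∈ Icc (0 : ℝ) 1, u l x = a + ∫ t in (0 : ℝ)..x, w l t := by
    intro l x hx
    have hsub : ∀ t ∈ uIoc 0 x, t ∈ Icc (0 : ℝ) 1 := by
      intro t ht
      rw [uIoc_of_le hx.1] at ht
      exact ⟨ht.1.le, ht.2.trans hx.2⟩
    have h1 : HasSum (fun n => ∫ t in (0 : ℝ)..x, (-l) ^ n * V n t) (∫ t in (0 : ℝ)..x, w l t) := by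
      refine intervalIntegral.hasSum_integral_of_dominated_convergence (fun n _ => M |l| n)
        ?_ ?_ ?_ ?_ ?_
      · intro n
        have : ContinuousOn (fun t => (-l) ^ n * V n t) (uIoc 0 x) :=
          (continuousOn_const.mul (hVc n)).mono hsub
        exact this.aestronglyMeasurable measurableSet_uIoc
      · exact fun n => MeasureTheory.ae_of_all _ fun t ht => hVb n le_rfl (hsub t ht)
      · exact MeasureTheory.ae_of_all _ fun t _ => hMs _
      · exact intervalIntegrable_const
      · exact MeasureTheory.ae_of_all _ fun t ht => (hVs l t (hsub t ht)).hasSum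
    have h2 : HasSum (fun n : ℕ => if n = 0 then a else 0) a := hasSum_ite_eq 0 a
    have h3 : (fun n => (-l) ^ n * U n x) = fun n =>
        (if n = 0 then a else 0) + ∫ t in (0 : ℝ)..x, (-l) ^ n * V n t := by
      funext n
      simp only [hU, hV]
      rw [stringCoeff_fst_eq, intervalIntegral.integral_const_mul]
      rcases n with _ | n
      · simp
      · simp
    simp only [hu]
    rw [h3]
    exact (h2.add h1).tsum_eq
  have hweq : ∀ l, ∀ x ∈ Icc (0 : ℝ) 1, w l x = b - l * ∫ t in (0 : ℝ)..x, p t * u l t := by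
    intro l x hx
    have hsub : ∀ t ∈ uIoc 0 x, t ∈ Icc (0 : ℝ) 1 := by
      intro t ht
      rw [uIoc_of_le hx.1] at ht
      exact ⟨ht.1.le, ht.2.trans hx.2⟩
    have h1 : HasSum (fun n => ∫ t in (0 : ℝ)..x, p t * ((-l) ^ n * U n t))
        (∫ t in (0 : ℝ)..x, p t * u l t) := by
      refine intervalIntegral.hasSum_integral_of_dominated_convergence (fun n _ => B * M |l| n)
        ?_ ?_ ?_ ?_ ?_
      · intro n
        have := hp.integrableOn_mul (continuousOn_const (c := (-l) ^ n) |>.mul (hUc n))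
        exact (this.mono_set hsub).aestronglyMeasurable
      · refine fun n => MeasureTheory.ae_of_all _ fun t ht => ?_
        rw [norm_mul]
        exact mul_le_mul (hB t (hsub t ht)) (hUb n le_rfl (hsub t ht)) (norm_nonneg _) hB0.le
      · exact MeasureTheory.ae_of_all _ fun t _ => (hMs _).mul_left _
      · exact intervalIntegrable_const
      · exact MeasureTheory.ae_of_all _ fun t ht => (hUs l t (hsub t ht)).hasSum.mul_left _
    simp only [hw]
    rw [(hVs l x hx).tsum_eq_zero_add, ← h1.tsum_eq, sub_eq_add_neg, ← neg_mul, ← tsum_mul_left]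
    congr 1
    · simp [hV, stringCoeff]
    · refine tsum_congr fun n => ?_
      have hI : ∫ t in (0 : ℝ)..x, p t * ((-l) ^ n * U n t) =
          (-l) ^ n * ∫ t in (0 : ℝ)..x, p t * U n t := by
        rw [← intervalIntegral.integral_const_mul]
        congr 1
        funext t
        ring
      rw [hI]
      simp only [hV, hU, stringCoeff]
      ring
  refine ⟨u, w, fun l => ⟨?_, hwl l, ?_⟩, ?_, huc, hwc⟩
  · intro x hx
    -- Instance for the fundamental theorem of calculus within `Icc 0 1`, end points included.
    have : Fact (x ∈ Icc (0 : ℝ) 1) := ⟨hx⟩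
    have hd := intervalIntegral.integral_hasDerivWithinAt_right (s := Icc 0 1) (t := Icc 0 1)
      (intervalIntegrable_of_integrableOn_Icc (hwl l).integrableOn_Icc hx)
      ((hwl l).stronglyMeasurableAtFilter_nhdsWithin measurableSet_Icc x) (hwl l x hx)
    exact (hd.const_add a).congr (fun y hy => hueq l y hy) (hueq l x hx)
  · intro x hx hc
    have hx' := Ioo_subset_Icc_self hx
    have hpu := hp.integrableOn_mul (hul l)
    have hcu : ContinuousAt (fun t => p t * u l t) x :=
      hc.mul ((hul l).continuousAt (Icc_mem_nhds hx.1 hx.2))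
    have hd := intervalIntegral.integral_hasDerivAt_right
      (intervalIntegrable_of_integrableOn_Icc hpu hx')
      ⟨Icc 0 1, Icc_mem_nhds hx.1 hx.2, hpu.aestronglyMeasurable⟩ hcu
    refine (((hd.const_mul l).const_sub b).congr_of_eventuallyEq ?_).congr_deriv (by ring)
    filter_upwards [Icc_mem_nhds hx.1 hx.2] with y hy
    exact hweq l y hy
  · intro l
    have h0 : (0 : ℝ) ∈ Icc (0 : ℝ) 1 := by simp
    exact ⟨by rw [hueq l 0 h0]; simp, by rw [hweq l 0 h0]; simp⟩

end Series

/-! ### Positivity of solutions. -/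

/-- Positivity near `0` must be uniform in `l` for `G` to be open. Under the Dirichlet condition
every solution vanishes at `0`, and uniformity comes from the derivative, which stays positive near
`(l, 0)`. -/
theorem IsStringSolution.eventually_pos_near_zero {p : ℝ → ℝ} {u w : ℝ → ℝ → ℝ}
    (h : ∀ l, IsStringSolution p l (u l) (w l))
    (hu : ContinuousOn (fun y : ℝ × ℝ => u y.1 y.2) (univ ×ˢ Icc 0 1))
    (hw : ContinuousOn (fun y : ℝ × ℝ => w y.1 y.2) (univ ×ˢ Icc 0 1)) {l : ℝ}
    (h0 : 0 < u l 0 ∨ (∀ k, u k 0 = 0) ∧ 0 < w l 0) :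
    ∀ᶠ y : ℝ × ℝ in 𝓝 (l, 0), y.2 ∈ Ioc (0 : ℝ) 1 → 0 < u y.1 y.2 := by
  have hmem : ((l, 0) : ℝ × ℝ) ∈ (univ ×ˢ Icc 0 1 : Set (ℝ × ℝ)) := by simp
  rcases h0 with h0 | ⟨hz, h0⟩
  · have := (hu (l, 0) hmem).eventually (lt_mem_nhds h0)
    rw [eventually_nhdsWithin_iff] at this
    filter_upwards [this] with y hy hy2
    exact hy ⟨mem_univ _, Ioc_subset_Icc_self hy2⟩
  · have := (hw (l, 0) hmem).eventually (lt_mem_nhds h0)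
    rw [eventually_nhdsWithin_iff, nhds_prod_eq, eventually_prod_iff] at this
    obtain ⟨P, hP, Q, hQ, hPQ⟩ := this
    obtain ⟨δ, hδ, hδQ⟩ := Metric.eventually_nhds_iff.1 hQ
    rw [nhds_prod_eq]
    filter_upwards [prod_mem_prod hP (Metric.ball_mem_nhds (0 : ℝ) hδ)] with y hy hy2
    obtain ⟨hyP, hyδ⟩ := hy
    rw [Metric.mem_ball, Real.dist_eq, sub_zero, abs_of_pos hy2.1] at hyδ
    have hsub : Icc 0 y.2 ⊆ Icc (0 : ℝ) 1 := Icc_subset_Icc_right hy2.2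
    have hm : StrictMonoOn (u y.1) (Icc 0 y.2) := by
      refine strictMonoOn_of_hasDerivWithinAt_pos (f' := w y.1) (convex_Icc _ _)
        ((h y.1).continuousOn.mono hsub) ?_ ?_
      · intro x hx
        rw [interior_Icc] at hx ⊢
        exact ((h y.1).hasDerivAt ⟨hx.1, hx.2.trans_le hy2.2⟩).hasDerivWithinAt
      · intro x hx
        rw [interior_Icc] at hx
        refine hPQ hyP (hδQ ?_) ⟨mem_univ _, hx.1.le, hx.2.le.trans hy2.2⟩
        rw [Real.dist_eq, sub_zero, abs_of_pos hx.1]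
        exact hx.2.trans hyδ
    have := hm (left_mem_Icc.2 hy2.1.le) (right_mem_Icc.2 hy2.1.le) hy2.1
    rwa [hz] at this

/-- Continuous induction for positivity on `(0, 1]`. -/
theorem forall_pos_of_continuous_induction {f : ℝ → ℝ} (hf : ContinuousOn f (Icc 0 1))
    (hnear : ∀ᶠ x in 𝓝 (0 : ℝ), x ∈ Ioc (0 : ℝ) 1 → 0 < f x)
    (hstep : ∀ x ∈ Ioc (0 : ℝ) 1, (∀ y ∈ Ioo 0 x, 0 < f y) → 0 < f x) :
    ∀ x ∈ Ioc (0 : ℝ) 1, 0 < f x := by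
  by_contra! hcon
  obtain ⟨y, hy, hfy⟩ := hcon
  obtain ⟨δ, hδ, hδf⟩ := Metric.eventually_nhds_iff.1 hnear
  have hsmall : ∀ x, 0 < x → x < δ → x ≤ 1 → 0 < f x := fun x hx0 hxδ hx1 =>
    hδf (by rwa [Real.dist_eq, sub_zero, abs_of_pos hx0]) ⟨hx0, hx1⟩
  -- The cut-off keeps out `0`, where `f` may vanish; the minimum with `y` keeps `y` in.
  set K := {x ∈ Icc (0 : ℝ) 1 | f x ∈ Iic 0} ∩ Ici (min δ y) with hK
  have hKc : IsCompact K := by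
    have h1 : IsClosed {x ∈ Icc (0 : ℝ) 1 | f x ∈ Iic 0} :=
      hf.preimage_isClosed_of_isClosed isClosed_Icc isClosed_Iic
    exact (isCompact_Icc.of_isClosed_subset h1 fun x hx => hx.1).inter_right isClosed_Ici
  obtain ⟨x, hxK, hxmin⟩ := hKc.exists_isLeast
    ⟨y, ⟨⟨hy.1.le, hy.2⟩, hfy⟩, mem_Ici.2 (min_le_right δ y)⟩
  have hx0 : 0 < x := lt_of_lt_of_le (lt_min hδ hy.1) hxK.2
  refine absurd (hstep x ⟨hx0, hxK.1.1.2⟩ ?_) (not_lt.2 hxK.1.2)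
  intro t ht
  by_contra! hft
  have ht1 : t ≤ 1 := ht.2.le.trans hxK.1.1.2
  have htδ : δ ≤ t := by
    by_contra! h
    exact absurd (hsmall t ht.1 h ht1) (not_lt.2 hft)
  exact absurd (hxmin ⟨⟨⟨ht.1.le, ht1⟩, hft⟩, mem_Ici.2 ((min_le_left _ _).trans htδ)⟩) (not_le.2 ht.2)

/-- For a sufficiently negative spectral parameter a solution whose Cauchy data dominate those of
`exp (K (x ^ 2 - x))` stays positive and has large logarithmic derivative at `1`. -/
theorem IsStringSolution.pos_of_very_negative {p u w : ℝ → ℝ} {c K : ℝ}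
    (hp : PiecewiseContinuous p) (hc : 0 < c) (hpc : ∀ x ∈ Icc (0 : ℝ) 1, c ≤ p x) (hK : 0 ≤ K)
    (h : IsStringSolution p (-((2 * K + K ^ 2) / c)) u w) (hu0 : 0 ≤ u 0)
    (hW : 0 < w 0 + K * u 0)
    (hnear : ∀ᶠ x in 𝓝 (0 : ℝ), x ∈ Ioc (0 : ℝ) 1 → 0 < u x) :
    (∀ x ∈ Ioc (0 : ℝ) 1, 0 < u x) ∧ K * u 1 < w 1 := by
  -- The comparison function `ψ = exp (K (x² - x))` has logarithmic derivative `-K` at `0` and `K`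
  -- at `1`, and `ψ'' ≤ (2 K + K²) ψ` on `[0, 1]`, which is where the spectral parameter comes from.
  set e : ℝ → ℝ := fun x => Real.exp (-(K * (x ^ 2 - x))) with he
  have hepos : ∀ x, 0 < e x := fun x => Real.exp_pos _
  have hec : Continuous e := by fun_prop
  have hed : ∀ x, HasDerivAt e (-(e x * (K * (2 * x - 1)))) x := by
    intro x
    have := (((((hasDerivAt_id x).pow 2).sub (hasDerivAt_id x)).const_mul K).neg).exp
    refine this.congr_deriv ?_
    simp [he]
  -- with `ψ = 1 / e`, this is the Wronskian of `ψ` and `u`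
  set W : ℝ → ℝ := fun x => (w x - u x * (K * (2 * x - 1))) / e x with hWdef
  have hWc : ContinuousOn W (Icc 0 1) :=
    (h.continuousOn_deriv.sub (h.continuousOn.mul (by fun_prop))).div hec.continuousOn
      fun x _ => (hepos x).ne'
  have hWmono : ∀ y ∈ Icc (0 : ℝ) 1, (∀ x ∈ Ioo 0 y, 0 < u x) → MonotoneOn W (Icc 0 y) := by
    intro y hy hpos
    refine monotoneOn_of_hasDerivAt_nonneg_off_finite hp.1
      (f' := fun x => (((2 * K + K ^ 2) / c) * p x - 2 * K - (K * (2 * x - 1)) ^ 2) * u x / e x)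
      (hWc.mono (Icc_subset_Icc_right hy.2)) ?_ ?_
    · intro x hx hxS
      have hx' : x ∈ Ioo (0 : ℝ) 1 := ⟨hx.1, hx.2.trans_le hy.2⟩
      have hcx : ContinuousAt p x := by
        by_contra hcx
        exact hxS ⟨hx', hcx⟩
      have hlin : HasDerivAt (fun x : ℝ => K * (2 * x - 1)) (K * 2) x := by
        simpa using (((hasDerivAt_id x).const_mul 2).sub_const 1).const_mul K
      have := ((h.equation x hx' hcx).sub ((h.hasDerivAt hx').mul hlin)).div (hed x) (hepos x).ne'
      refine this.congr_deriv ?_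
      have := (hepos x).ne'
      simp only [Pi.sub_apply, Pi.mul_apply]
      field_simp
      ring
    · intro x hx _
      have hx' : x ∈ Icc (0 : ℝ) 1 := ⟨hx.1.le, hx.2.le.trans hy.2⟩
      have h1 : 2 * K + K ^ 2 ≤ ((2 * K + K ^ 2) / c) * p x := by
        have := mul_le_mul_of_nonneg_left (hpc x hx')
          (show 0 ≤ (2 * K + K ^ 2) / c by positivity)
        rwa [div_mul_cancel₀ _ hc.ne'] at this
      have h2 : (2 * x - 1) ^ 2 ≤ 1 := by nlinarith [hx'.1, hx'.2]
      have h3 : (K * (2 * x - 1)) ^ 2 ≤ K ^ 2 := by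
        rw [mul_pow]
        exact mul_le_of_le_one_right (sq_nonneg K) h2
      exact div_nonneg (mul_nonneg (by linarith) (hpos x hx).le) (hepos x).le
  have hW0 : 0 < W 0 := by
    simp only [hWdef]
    refine div_pos ?_ (hepos 0)
    linarith
  have hpos : ∀ x ∈ Ioc (0 : ℝ) 1, 0 < u x := by
    refine forall_pos_of_continuous_induction h.continuousOn hnear ?_
    intro y hy hposy
    have hy' := Ioc_subset_Icc_self hy
    have hWm := hWmono y hy' hposy
    -- This is `u / ψ`, with derivative `W / ψ²`.
    have hm : StrictMonoOn (fun x => u x * e x) (Icc 0 y) := by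
      refine strictMonoOn_of_hasDerivWithinAt_pos (f' := fun x => W x * e x ^ 2) (convex_Icc _ _)
        ((h.continuousOn.mul hec.continuousOn).mono (Icc_subset_Icc_right hy.2)) ?_ ?_
      · intro x hx
        rw [interior_Icc] at hx ⊢
        refine (((h.hasDerivAt ⟨hx.1, hx.2.trans_le hy.2⟩).mul (hed x)).congr_deriv
          ?_).hasDerivWithinAt
        have := (hepos x).ne'
        simp only [hWdef]
        field_simp
        ring
      · intro x hx
        rw [interior_Icc] at hx
        have := hWm (left_mem_Icc.2 hy.1.le) (Ioo_subset_Icc_self hx) hx.1.le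
        have hex := hepos x
        have : 0 < W x := hW0.trans_le this
        positivity
    have h1 := hm (left_mem_Icc.2 hy.1.le) (right_mem_Icc.2 hy.1.le) hy.1
    have h2 : 0 ≤ u 0 * e 0 := mul_nonneg hu0 (hepos 0).le
    exact pos_of_mul_pos_left (h2.trans_lt h1) (hepos y).le
  refine ⟨hpos, ?_⟩
  have h1 := hWmono 1 (by simp) (fun x hx => hpos x (Ioo_subset_Ioc_self hx))
    (left_mem_Icc.2 zero_le_one) (right_mem_Icc.2 zero_le_one) zero_le_one
  have h2 : 0 < W 1 := hW0.trans_le h1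
  simp only [hWdef] at h2
  rw [div_pos_iff_of_pos_right (hepos 1)] at h2
  linarith

/-! ### Boundary conditions and the shooting argument. -/

theorem isStringSolution_sin :
    IsStringSolution (fun _ => 1) (Real.pi ^ 2) (fun x => Real.sin (Real.pi * x))
      (fun x => Real.pi * Real.cos (Real.pi * x)) where
  hasDeriv x _ := by
    have := ((hasDerivAt_id x).const_mul Real.pi).sin
    refine (this.congr_deriv ?_).hasDerivWithinAt
    simp [mul_comm]
  continuousOn_deriv := by fun_prop
  equation x _ _ := by
    have := (((hasDerivAt_id x).const_mul Real.pi).cos).const_mul Real.pi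
    refine this.congr_deriv ?_
    simp
    ring

theorem piecewiseContinuous_one : PiecewiseContinuous fun _ => 1 :=
  ⟨by simp [continuousAt_const], fun _ _ => ⟨1, tendsto_const_nhds⟩,
    fun _ _ => ⟨1, tendsto_const_nhds⟩⟩

theorem isDensity_one : IsDensity fun _ => 1 :=
  ⟨piecewiseContinuous_one, 1, one_pos, fun _ _ => le_rfl⟩

/-- Both Cauchy vectors are orthogonal to the unit vector `(cos γ, sin γ)`, so their Wronskian
vanishes. If `u e = 0`, the condition is Dirichlet and `v e = 0` too. -/
theorem piconeBoundary_of_boundary_condition {u w v z : ℝ → ℝ} {e γ : ℝ}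
    (hu : u e * Real.cos γ + w e * Real.sin γ = 0) (hv : v e * Real.cos γ + z e * Real.sin γ = 0)
    (hne : ¬ (u e = 0 ∧ w e = 0)) : PiconeBoundary u w v z e := by
  have hcs := Real.sin_sq_add_cos_sq γ
  by_cases hue : u e = 0
  · have hwe : w e ≠ 0 := fun h => hne ⟨hue, h⟩
    have hs : Real.sin γ = 0 := by simpa [hue, hwe] using hu
    have hc : Real.cos γ ≠ 0 := by
      intro hc
      simp [hs, hc] at hcs
    exact Or.inr ⟨hue, hwe, by simpa [hs, hc] using hv⟩
  · refine Or.inl ⟨hue, ?_⟩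
    have h1 : z e * u e - v e * w e = 0 := by
      linear_combination (-(z e * u e - v e * w e)) * hcs +
        (z e * Real.cos γ - v e * Real.sin γ) * hu + (u e * Real.sin γ - w e * Real.cos γ) * hv
    rw [h1, mul_zero]

/-- Supplies one `K` whose comparison function beats both boundary conditions: `-cos α + K sin α`
and `cos β + K sin β` are positive. -/
theorem exists_nonneg_lincomb_pos {c s c' s' : ℝ} (hs : 0 ≤ s) (hs' : 0 ≤ s')
    (h : 0 < s ∨ 0 < c) (h' : 0 < s' ∨ 0 < c') :
    ∃ K : ℝ, 0 ≤ K ∧ 0 < c + K * s ∧ 0 < c' + K * s' := by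
  have key : ∀ {c s : ℝ}, 0 ≤ s → (0 < s ∨ 0 < c) → ∀ᶠ K in atTop, 0 < c + K * s := by
    intro c s hs h
    rcases h with h | h
    · exact (tendsto_atTop_add_const_left _ c (tendsto_id.atTop_mul_const h)).eventually_gt_atTop 0
    · filter_upwards [eventually_ge_atTop 0] with K hK
      positivity
  exact ((eventually_ge_atTop 0).and ((key hs h).and (key hs' h'))).exists

/-- Existence of an eigenvalue with an eigenfunction that is positive in `(0, 1)`. -/
theorem exists_positive_eigenfunction {p : ℝ → ℝ} (hp : IsDensity p) {α β : ℝ}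
    (hα : α ∈ Set.Ioc 0 Real.pi) (hβ : β ∈ Set.Ico 0 Real.pi) :
    ∃ (l : ℝ) (u w : ℝ → ℝ), IsStringSolution p l u w ∧ (∀ x ∈ Ioo (0 : ℝ) 1, 0 < u x) ∧
      u 0 * Real.cos α + w 0 * Real.sin α = 0 ∧ u 1 * Real.cos β + w 1 * Real.sin β = 0 := by
  obtain ⟨hpc, c, hc, hpge⟩ := hp
  obtain ⟨u, w, hsol, hinit, huc, hwc⟩ :=
    exists_stringSolution_family (Real.sin α) (-Real.cos α) hpc
  have hu0 : ∀ l, u l 0 = Real.sin α := fun l => (hinit l).1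
  have hw0 : ∀ l, w l 0 = -Real.cos α := fun l => (hinit l).2
  have hsα : 0 ≤ Real.sin α := Real.sin_nonneg_of_nonneg_of_le_pi hα.1.le hα.2
  have hsβ : 0 ≤ Real.sin β := Real.sin_nonneg_of_nonneg_of_le_pi hβ.1 hβ.2.le
  have hα' : 0 < Real.sin α ∨ Real.sin α = 0 ∧ 0 < -Real.cos α := by
    rcases hα.2.eq_or_lt with h | h
    · right
      rw [h]
      simp
    · exact Or.inl (Real.sin_pos_of_pos_of_lt_pi hα.1 h)
  have hβ' : 0 < Real.sin β ∨ Real.sin β = 0 ∧ 0 < Real.cos β := by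
    rcases hβ.1.eq_or_lt with h | h
    · right
      rw [← h]
      simp
    · exact Or.inl (Real.sin_pos_of_pos_of_lt_pi h hβ.2)
  have hdata : ∀ l, ∀ x ∈ Icc (0 : ℝ) 1, ¬ (u l x = 0 ∧ w l x = 0) := by
    rintro l x hx ⟨h1, h2⟩
    have := (hsol l).eq_zero_of_cauchy_data hpc hx h1 h2 (x := 0) (by simp)
    rw [hu0, hw0] at this
    have hcs := Real.sin_sq_add_cos_sq α
    rw [this.1, neg_eq_zero.1 this.2] at hcs
    norm_num at hcs
  have hnear : ∀ l, ∀ᶠ y : ℝ × ℝ in 𝓝 (l, 0), y.2 ∈ Ioc (0 : ℝ) 1 → 0 < u y.1 y.2 := by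
    intro l
    refine IsStringSolution.eventually_pos_near_zero hsol huc hwc ?_
    simp only [hu0, hw0]
    exact hα'.imp_right fun h => ⟨fun _ => h.1, h.2⟩
  have hul : ∀ x ∈ Icc (0 : ℝ) 1, Continuous fun l => u l x := fun x hx =>
    huc.comp_continuous (f := fun l => (l, x)) (by fun_prop) fun l => ⟨mem_univ _, hx⟩
  have hwl : ∀ x ∈ Icc (0 : ℝ) 1, Continuous fun l => w l x := fun x hx =>
    hwc.comp_continuous (f := fun l => (l, x)) (by fun_prop) fun l => ⟨mem_univ _, hx⟩
  set D : ℝ → ℝ := fun l => u l 1 * Real.cos β + w l 1 * Real.sin β with hD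
  have hDc : Continuous D :=
    ((hul 1 (by simp)).mul continuous_const).add ((hwl 1 (by simp)).mul continuous_const)
  set G : Set ℝ := {l | (∀ x ∈ Ioc (0 : ℝ) 1, 0 < u l x) ∧ 0 < D l} with hG
  have hGne : G.Nonempty := by
    obtain ⟨K, hK, h1, h2⟩ := exists_nonneg_lincomb_pos hsα hsβ
      (hα'.imp_right fun h => h.2) (hβ'.imp_right fun h => h.2)
    set l := -((2 * K + K ^ 2) / c) with hl
    have hnl : ∀ᶠ x in 𝓝 (0 : ℝ), x ∈ Ioc (0 : ℝ) 1 → 0 < u l x :=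
      (Continuous.tendsto (f := fun x : ℝ => (l, x)) (by fun_prop) 0).eventually (hnear l)
    obtain ⟨hpos, hK1⟩ := (hsol l).pos_of_very_negative hpc hc hpge hK (by rwa [hu0])
      (by rw [hu0, hw0]; exact h1) hnl
    refine ⟨l, hpos, ?_⟩
    have h3 := mul_pos (hpos 1 (by simp)) h2
    have h4 := mul_le_mul_of_nonneg_right hK1.le hsβ
    simp only [hD]
    linarith
  have hGb : BddAbove G := by
    -- Beyond this value `l p > π²`, and Picone applies with `v = sin (π x)`, which vanishes at both
    -- ends and so need not share the boundary conditions of `u l`.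
    refine ⟨Real.pi ^ 2 / c, fun l hl => ?_⟩
    by_contra! hlt
    rw [div_lt_iff₀ hc] at hlt
    have hl0 : 0 < l := by
      by_contra! h
      nlinarith [Real.pi_pos]
    refine (hsol l).picone isStringSolution_sin hpc piecewiseContinuous_one
      (fun x hx => hl.1 x (Ioo_subset_Ioc_self hx)) ⟨1 / 2, by norm_num, ?_⟩ ?_ ?_ ?_
    · simp [← div_eq_mul_inv]
    · by_cases h0 : u l 0 = 0
      · exact Or.inr ⟨h0, fun h => hdata l 0 (by simp) ⟨h0, h⟩, by simp⟩
      · exact Or.inl ⟨h0, by simp⟩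
    · exact Or.inl ⟨(hl.1 1 (by simp)).ne', by simp⟩
    · intro x hx
      have := mul_le_mul_of_nonneg_left (hpge x (Ioo_subset_Icc_self hx)) hl0.le
      linarith
  have hGopen : ∀ l ∈ G, ∀ᶠ k in 𝓝 l, k ∈ G := by
    intro l hl
    have h1 : ∀ᶠ k in 𝓝 l, ∀ x ∈ Icc (0 : ℝ) 1, x ∈ Ioc (0 : ℝ) 1 → 0 < u k x := by
      refine isCompact_Icc.eventually_forall_of_forall_eventually
        (P := fun k x => x ∈ Ioc (0 : ℝ) 1 → 0 < u k x) ?_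
      intro x hx
      rcases hx.1.eq_or_lt with h | h
      · rw [← h]
        exact hnear l
      · have := (huc (l, x) ⟨mem_univ _, hx⟩).eventually (lt_mem_nhds (hl.1 x ⟨h, hx.2⟩))
        rw [eventually_nhdsWithin_iff] at this
        filter_upwards [this] with y hy hy2
        exact hy ⟨mem_univ _, Ioc_subset_Icc_self hy2⟩
    filter_upwards [h1, hDc.continuousAt.eventually (lt_mem_nhds hl.2)] with k hk hkD
    exact ⟨fun x hx => hk x (Ioc_subset_Icc_self hx) hx, hkD⟩
  set l := sSup G with hl
  have hlcl : l ∈ closure G := csSup_mem_closure hGne hGb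
  have hlG : l ∉ G := by
    intro hmem
    obtain ⟨ε, hε, hεG⟩ := Metric.eventually_nhds_iff.1 (hGopen l hmem)
    have : l + ε / 2 ∈ G := hεG (by
      rw [Real.dist_eq, add_sub_cancel_left, abs_of_pos (by positivity)]
      linarith)
    have := le_csSup hGb this
    linarith
  have hunn : ∀ x ∈ Icc (0 : ℝ) 1, 0 ≤ u l x := by
    intro x hx
    rcases hx.1.eq_or_lt with h | h
    · rw [← h, hu0]
      exact hsα
    · exact closure_minimal (fun k hk => (hk.1 x ⟨h, hx.2⟩).le)
        (isClosed_le continuous_const (hul x hx)) hlcl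
  have hDnn : 0 ≤ D l :=
    closure_minimal (fun k hk => hk.2.le) (isClosed_le continuous_const hDc) hlcl
  -- An interior zero of a nonnegative solution is a minimum, hence a double zero.
  have hpos : ∀ x ∈ Ioo (0 : ℝ) 1, 0 < u l x := by
    intro x hx
    have hx' := Ioo_subset_Icc_self hx
    refine (hunn x hx').lt_of_ne fun h0 => hdata l x hx' ⟨h0.symm, ?_⟩
    have hmin : IsLocalMin (u l) x := by
      filter_upwards [Icc_mem_nhds hx.1 hx.2] with y hy
      rw [← h0]
      exact hunn y hy
    exact hmin.hasDerivAt_eq_zero ((hsol l).hasDerivAt hx)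
  refine ⟨l, u l, w l, hsol l, hpos, ?_, ?_⟩
  · rw [hu0, hw0]
    ring
  -- If `u l 1 = 0`, then `w l 1 ≤ 0` and so `D l ≤ 0`. If `u l 1 > 0`, then `D l > 0` would put `l`
  -- in `G`, which openness excludes for the supremum.
  · rcases (hunn 1 (by simp)).eq_or_lt with h1 | h1
    · have hw1 : w l 1 ≤ 0 := by
        have hd := (hsol l).hasDeriv 1 (by simp)
        rw [hasDerivWithinAt_iff_tendsto_slope] at hd
        have hne : (𝓝[Icc (0 : ℝ) 1 \ {1}] 1).NeBot := by
          rw [Icc_sdiff_right]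
          exact right_nhdsWithin_Ico_neBot zero_lt_one
        refine le_of_tendsto hd ?_
        filter_upwards [self_mem_nhdsWithin] with y hy
        rw [slope_def_field, ← h1, sub_zero]
        exact div_nonpos_of_nonneg_of_nonpos (hunn y hy.1) (by linarith [hy.1.2])
      refine le_antisymm ?_ hDnn
      rw [← h1, zero_mul, zero_add]
      exact mul_nonpos_of_nonpos_of_nonneg hw1 hsβ
    · by_contra hne
      refine hlG ⟨fun x hx => ?_, lt_of_le_of_ne hDnn (Ne.symm hne)⟩
      rcases hx.2.eq_or_lt with h | h
      · rwa [h]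
      · exact hpos x ⟨hx.1, h⟩

/-! ### Reality of eigenvalues and Sturm comparison. -/

theorem IsStringSolution.isStringEigenvalue {p u w : ℝ → ℝ} {l α β : ℝ}
    (h : IsStringSolution p l u w) (h0 : u 0 * Real.cos α + w 0 * Real.sin α = 0)
    (h1 : u 1 * Real.cos β + w 1 * Real.sin β = 0) (hne : ∃ x ∈ Icc (0 : ℝ) 1, u x ≠ 0) :
    IsStringEigenvalue p α β (l : ℂ) := by
  refine ⟨fun x => (u x : ℂ), fun x => (w x : ℂ), ?_, ?_, ?_, ?_, ?_, ?_⟩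
  · exact fun x hx => (h.hasDeriv x hx).ofReal_comp
  · exact Complex.continuous_ofReal.comp_continuousOn h.continuousOn_deriv
  · intro x hx hc
    refine (h.equation x hx hc).ofReal_comp.congr_deriv ?_
    push_cast
    ring
  · exact_mod_cast congrArg (fun t : ℝ => (t : ℂ)) h0
  · exact_mod_cast congrArg (fun t : ℝ => (t : ℂ)) h1
  · obtain ⟨x, hx, hux⟩ := hne
    exact ⟨x, hx, by exact_mod_cast hux⟩

theorem mul_sub_mul_eq_zero_of_boundary {ur ui wr wi γ : ℝ}
    (hr : ur * Real.cos γ + wr * Real.sin γ = 0) (hi : ui * Real.cos γ + wi * Real.sin γ = 0) :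
    wi * ur - wr * ui = 0 := by
  linear_combination (-(wi * ur - wr * ui)) * Real.sin_sq_add_cos_sq γ +
    (wi * Real.cos γ - ui * Real.sin γ) * hr + (ur * Real.sin γ - wr * Real.cos γ) * hi

/-- Eigenvalues are real and possess real eigenfunctions. -/
theorem IsStringEigenvalue.exists_real_solution {p : ℝ → ℝ} (hp : IsDensity p) {α β : ℝ} {μ : ℂ}
    (h : IsStringEigenvalue p α β μ) :
    μ.im = 0 ∧ ∃ v z : ℝ → ℝ, IsStringSolution p μ.re v z ∧
      v 0 * Real.cos α + z 0 * Real.sin α = 0 ∧ v 1 * Real.cos β + z 1 * Real.sin β = 0 ∧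
      ∃ x ∈ Icc (0 : ℝ) 1, v x ≠ 0 := by
  obtain ⟨hpc, c, hc, hpge⟩ := hp
  obtain ⟨u, w, hd, hwc, heq, hb0, hb1, hne⟩ := h
  have hdr : ∀ x ∈ Icc (0 : ℝ) 1,
      HasDerivWithinAt (fun x => (u x).re) (w x).re (Icc 0 1) x := fun x hx =>
    Complex.reCLM.hasFDerivAt.comp_hasDerivWithinAt x (hd x hx)
  have hdi : ∀ x ∈ Icc (0 : ℝ) 1,
      HasDerivWithinAt (fun x => (u x).im) (w x).im (Icc 0 1) x := fun x hx =>
    Complex.imCLM.hasFDerivAt.comp_hasDerivWithinAt x (hd x hx)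
  have hwr : ContinuousOn (fun x => (w x).re) (Icc 0 1) :=
    Complex.continuous_re.comp_continuousOn hwc
  have hwi : ContinuousOn (fun x => (w x).im) (Icc 0 1) :=
    Complex.continuous_im.comp_continuousOn hwc
  have her : ∀ x ∈ Ioo (0 : ℝ) 1, ContinuousAt p x → HasDerivAt (fun x => (w x).re)
      (-(p x * (μ.re * (u x).re - μ.im * (u x).im))) x := by
    intro x hx hcx
    refine (Complex.reCLM.hasFDerivAt.comp_hasDerivAt x (heq x hx hcx)).congr_deriv ?_
    simp
    ring
  have hei : ∀ x ∈ Ioo (0 : ℝ) 1, ContinuousAt p x → HasDerivAt (fun x => (w x).im)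
      (-(p x * (μ.re * (u x).im + μ.im * (u x).re))) x := by
    intro x hx hcx
    refine (Complex.imCLM.hasFDerivAt.comp_hasDerivAt x (heq x hx hcx)).congr_deriv ?_
    simp
    ring
  have hb0r : (u 0).re * Real.cos α + (w 0).re * Real.sin α = 0 := by
    simpa [-Complex.ofReal_cos, -Complex.ofReal_sin] using congrArg Complex.re hb0
  have hb0i : (u 0).im * Real.cos α + (w 0).im * Real.sin α = 0 := by
    simpa [-Complex.ofReal_cos, -Complex.ofReal_sin] using congrArg Complex.im hb0
  have hb1r : (u 1).re * Real.cos β + (w 1).re * Real.sin β = 0 := by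
    simpa [-Complex.ofReal_cos, -Complex.ofReal_sin] using congrArg Complex.re hb1
  have hb1i : (u 1).im * Real.cos β + (w 1).im * Real.sin β = 0 := by
    simpa [-Complex.ofReal_cos, -Complex.ofReal_sin] using congrArg Complex.im hb1
  have huc : ContinuousOn u (Icc 0 1) := fun x hx => (hd x hx).continuousWithinAt
  have hreal : μ.im = 0 := by
    by_contra him
    have hmu : 0 < μ.im ^ 2 := by positivity
    obtain ⟨x, hx, hxS, hux⟩ := exists_ne_zero_off_finite hpc.1 huc hne
    -- Lagrange's identity: `Im (conj u * w)` has derivative `-μ.im * p * |u|²` and vanishes at both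
    -- ends. The factor `-μ.im` makes the derivative nonnegative whatever the sign of `μ.im`.
    have hz := deriv_eq_zero_of_nonneg_of_endpoints_eq hpc.1
      (f := fun x => -μ.im * ((w x).im * (u x).re - (w x).re * (u x).im))
      (f' := fun x => μ.im ^ 2 * p x * ((u x).re ^ 2 + (u x).im ^ 2)) ?_ ?_ ?_ ?_ hx hxS
    · have h1 : 0 < p x := hc.trans_le (hpge x (Ioo_subset_Icc_self hx))
      have h2 : 0 < (u x).re ^ 2 + (u x).im ^ 2 := by
        have := Complex.normSq_pos.2 hux
        rw [Complex.normSq_apply] at this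
        nlinarith
      have := mul_pos (mul_pos hmu h1) h2
      exact this.ne' hz
    · exact continuousOn_const.mul
        ((hwi.mul (Complex.continuous_re.comp_continuousOn huc)).sub
          (hwr.mul (Complex.continuous_im.comp_continuousOn huc)))
    · intro y hy hyS
      have hcy : ContinuousAt p y := by
        by_contra hcy
        exact hyS ⟨hy, hcy⟩
      have hy' := Icc_mem_nhds hy.1 hy.2
      have hr := (hdr y (Ioo_subset_Icc_self hy)).hasDerivAt hy'
      have hi := (hdi y (Ioo_subset_Icc_self hy)).hasDerivAt hy'
      refine ((((hei y hy hcy).mul hr).sub ((her y hy hcy).mul hi)).const_mul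
        (-μ.im)).congr_deriv ?_
      ring
    · intro y hy _
      have h1 : 0 < p y := hc.trans_le (hpge y (Ioo_subset_Icc_self hy))
      positivity
    · simp only [mul_sub_mul_eq_zero_of_boundary hb0r hb0i,
        mul_sub_mul_eq_zero_of_boundary hb1r hb1i]
  refine ⟨hreal, ?_⟩
  obtain ⟨x, hx, hux⟩ := hne
  by_cases hre : (u x).re = 0
  · have him : (u x).im ≠ 0 := fun h => hux (Complex.ext hre h)
    refine ⟨fun x => (u x).im, fun x => (w x).im, ⟨hdi, hwi, ?_⟩, hb0i, hb1i, x, hx, him⟩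
    intro y hy hcy
    refine (hei y hy hcy).congr_deriv ?_
    rw [hreal]
    ring
  · refine ⟨fun x => (u x).re, fun x => (w x).re, ⟨hdr, hwr, ?_⟩, hb0r, hb1r, x, hx, hre⟩
    intro y hy hcy
    refine (her y hy hcy).congr_deriv ?_
    rw [hreal]
    ring

/-- Sturm comparison between an eigenvalue with a positive eigenfunction and any eigenvalue of a
second string with the same boundary conditions. -/
theorem IsStringEigenvalue.not_forall_lt {p q : ℝ → ℝ} (hp : IsDensity p) (hq : IsDensity q)
    {α β l : ℝ} {u w : ℝ → ℝ} (hu : IsStringSolution p l u w)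
    (hpos : ∀ x ∈ Ioo (0 : ℝ) 1, 0 < u x)
    (h0 : u 0 * Real.cos α + w 0 * Real.sin α = 0) (h1 : u 1 * Real.cos β + w 1 * Real.sin β = 0)
    {μ : ℂ} (h : IsStringEigenvalue q α β μ) :
    ¬ ∀ x ∈ Ioo (0 : ℝ) 1, μ.re * q x < l * p x := by
  obtain ⟨-, v, z, hv, hv0, hv1, hne⟩ := h.exists_real_solution hq
  have hdata : ∀ x ∈ Icc (0 : ℝ) 1, ¬ (u x = 0 ∧ w x = 0) := by
    rintro x hx ⟨h1, h2⟩
    have := hu.eq_zero_of_cauchy_data hp.piecewiseContinuous hx h1 h2 (x := 1 / 2) (by norm_num)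
    exact (hpos (1 / 2) (by norm_num)).ne' this.1
  exact hu.picone hv hp.piecewiseContinuous hq.piecewiseContinuous hpos hne
    (piconeBoundary_of_boundary_condition h0 hv0 (hdata 0 (by simp)))
    (piconeBoundary_of_boundary_condition h1 hv1 (hdata 1 (by simp)))

theorem IsLowestEigenvalue.lowestEigenvalue_eq {p : ℝ → ℝ} {α β l : ℝ}
    (h : IsLowestEigenvalue p α β l) : lowestEigenvalue p α β = l :=
  IsLeast.csInf_eq ⟨h.1, fun k hk => (h.2 k hk).2⟩

/-- The lowest eigenvalue exists and has a positive eigenfunction. -/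
theorem exists_positive_eigenfunction_lowestEigenvalue {p : ℝ → ℝ} (hp : IsDensity p) {α β : ℝ}
    (hα : α ∈ Set.Ioc 0 Real.pi) (hβ : β ∈ Set.Ico 0 Real.pi) :
    IsLowestEigenvalue p α β (lowestEigenvalue p α β) ∧
    ∃ u w : ℝ → ℝ, IsStringSolution p (lowestEigenvalue p α β) u w ∧
      (∀ x ∈ Ioo (0 : ℝ) 1, 0 < u x) ∧
      u 0 * Real.cos α + w 0 * Real.sin α = 0 ∧ u 1 * Real.cos β + w 1 * Real.sin β = 0 := by
  obtain ⟨l, u, w, hu, hpos, h0, h1⟩ := exists_positive_eigenfunction hp hα hβ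
  have hlow : IsLowestEigenvalue p α β l := by
    refine ⟨hu.isStringEigenvalue h0 h1
      ⟨1 / 2, by norm_num, (hpos (1 / 2) (by norm_num)).ne'⟩, fun μ hμ => ?_⟩
    refine ⟨(hμ.exists_real_solution hp).1, ?_⟩
    by_contra! hlt
    obtain ⟨c, hc, hpge⟩ := hp.bounded_away
    exact hμ.not_forall_lt hp hp hu hpos h0 h1 fun x hx =>
      mul_lt_mul_of_pos_right hlt (hc.trans_le (hpge x (Ioo_subset_Icc_self hx)))
  rw [hlow.lowestEigenvalue_eq]
  exact ⟨hlow, u, w, hu, hpos, h0, h1⟩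

/-! ### The bounds for the lowest eigenvalue. -/

theorem lowestEigenvalue_not_forall_lt {p q : ℝ → ℝ} (hp : IsDensity p) (hq : IsDensity q)
    {α β : ℝ} (hα : α ∈ Set.Ioc 0 Real.pi) (hβ : β ∈ Set.Ico 0 Real.pi) :
    ¬ ∀ x ∈ Ioo (0 : ℝ) 1, lowestEigenvalue q α β * q x < lowestEigenvalue p α β * p x := by
  obtain ⟨-, u, w, hu, hpos, h0, h1⟩ := exists_positive_eigenfunction_lowestEigenvalue hp hα hβ
  have hq' := (exists_positive_eigenfunction_lowestEigenvalue hq hα hβ).1.1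
  simpa using hq'.not_forall_lt hp hq hu hpos h0 h1

theorem IsDensity.pos_and_inv_bounds {p : ℝ → ℝ} (hp : IsDensity p) {x : ℝ}
    (hx : x ∈ Icc (0 : ℝ) 1) : 0 < p x ∧ infInv p ≤ (p x)⁻¹ ∧ (p x)⁻¹ ≤ supInv p := by
  obtain ⟨c, hc, hpge⟩ := hp.bounded_away
  refine ⟨hc.trans_le (hpge x hx), csInf_le ⟨0, ?_⟩ ⟨x, hx, rfl⟩, le_csSup ⟨c⁻¹, ?_⟩ ⟨x, hx, rfl⟩⟩
  · rintro _ ⟨y, hy, rfl⟩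
    exact inv_nonneg.2 (hc.le.trans (hpge y hy))
  · rintro _ ⟨y, hy, rfl⟩
    exact inv_anti₀ hc (hpge y hy)

/-- Bounding by `λ₀(1) / p x` pointwise treats both signs of `λ₀(1)` at once; the sign only decides
whether `infInv p` or `supInv p` gives the constant `k`. -/
theorem le_lowestEigenvalue_of_forall_le {p : ℝ → ℝ} (hp : IsDensity p) {α β k : ℝ}
    (hα : α ∈ Set.Ioc 0 Real.pi) (hβ : β ∈ Set.Ico 0 Real.pi)
    (hk : ∀ x ∈ Icc (0 : ℝ) 1, k ≤ lowestEigenvalue (fun _ => 1) α β * (p x)⁻¹) :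
    k ≤ lowestEigenvalue p α β := by
  by_contra! hlt
  refine lowestEigenvalue_not_forall_lt isDensity_one hp hα hβ fun x hx => ?_
  have hx' := Ioo_subset_Icc_self hx
  rw [mul_one, ← lt_div_iff₀ (hp.pos_and_inv_bounds hx').1, div_eq_mul_inv]
  exact hlt.trans_le (hk x hx')

theorem lowestEigenvalue_le_of_forall_le {p : ℝ → ℝ} (hp : IsDensity p) {α β k : ℝ}
    (hα : α ∈ Set.Ioc 0 Real.pi) (hβ : β ∈ Set.Ico 0 Real.pi)
    (hk : ∀ x ∈ Icc (0 : ℝ) 1, lowestEigenvalue (fun _ => 1) α β * (p x)⁻¹ ≤ k) :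
    lowestEigenvalue p α β ≤ k := by
  by_contra! hlt
  refine lowestEigenvalue_not_forall_lt hp isDensity_one hα hβ fun x hx => ?_
  have hx' := Ioo_subset_Icc_self hx
  rw [mul_one, ← div_lt_iff₀ (hp.pos_and_inv_bounds hx').1, div_eq_mul_inv]
  exact (hk x hx').trans_lt hlt

theorem theorem3p2 (p : ℝ → ℝ) (hp : IsDensity p) (α β : ℝ)
    (hα : α ∈ Set.Ioc 0 Real.pi) (hβ : β ∈ Set.Ico 0 Real.pi) :
    IsLowestEigenvalue p α β (lowestEigenvalue p α β) ∧
    IsLowestEigenvalue (fun _ => 1) α β (lowestEigenvalue (fun _ => 1) α β) ∧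
    (0 ≤ lowestEigenvalue (fun _ => 1) α β →
      lowestEigenvalue (fun _ => 1) α β * infInv p ≤ lowestEigenvalue p α β ∧
      lowestEigenvalue p α β ≤ lowestEigenvalue (fun _ => 1) α β * supInv p) ∧
    (lowestEigenvalue (fun _ => 1) α β ≤ 0 →
      lowestEigenvalue (fun _ => 1) α β * supInv p ≤ lowestEigenvalue p α β ∧
      lowestEigenvalue p α β ≤ lowestEigenvalue (fun _ => 1) α β * infInv p) := by
  refine ⟨(exists_positive_eigenfunction_lowestEigenvalue hp hα hβ).1,
    (exists_positive_eigenfunction_lowestEigenvalue isDensity_one hα hβ).1, fun h => ⟨?_, ?_⟩,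
    fun h => ⟨?_, ?_⟩⟩
  · exact le_lowestEigenvalue_of_forall_le hp hα hβ fun x hx =>
      mul_le_mul_of_nonneg_left (hp.pos_and_inv_bounds hx).2.1 h
  · exact lowestEigenvalue_le_of_forall_le hp hα hβ fun x hx =>
      mul_le_mul_of_nonneg_left (hp.pos_and_inv_bounds hx).2.2 h
  · exact le_lowestEigenvalue_of_forall_le hp hα hβ fun x hx =>
      mul_le_mul_of_nonpos_left (hp.pos_and_inv_bounds hx).2.2 h
  · exact lowestEigenvalue_le_of_forall_le hp hα hβ fun x hx =>
      mul_le_mul_of_nonpos_left (hp.pos_and_inv_bounds hx).2.1 h
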